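/- Let $\Omega\subset\mathbb R^2$ be a domain, i.e. a bounded connected open set with Lipschitz-continuous boundary, lying locally on one side of its boundary. Let $T>0$, $2.8\le p\le 5$, $p'=p/(p-1)$, $\alpha=\frac{3p-1}{2p}$ (so $1<\alpha<2$), $\kappa>0$, let $N\ge1$ be an integer and put $\ell=T/N$. Let $\mu:\overline\Omega\to\mathbb R$ be measurable with $\mu_1\le\mu(x)\le\mu_2$ for all $x\in\overline\Omega$, for some constants $\mu_1,\mu_2>0$, and let $\tilde a\in W^{1,p}(0,T;\mathcal C^0(\overline\Omega))$. Write $\{s\}^-=\frac{|s|-s}{2}$ for the negative part of $s\in\mathbb R$, and $K=\{v\in W_0^{1,p}(\Omega):\ v\ge0\}$. For $0\le n\le N-1$ and given $u^n\in W_0^{1,p}(\Omega)$, let $\mathcal P_\kappa^{n+1}$ be the problem of finding $u^{n+1}\in W_0^{1,p}(\Omega)$ such that $$\frac1\ell\left\{|u^{n+1}|^{\alpha-2}u^{n+1}-|u^n|^{\alpha-2}u^n\right\}-\nabla\cdot\left(\mu|\nabla u^{n+1}|^{p-2}\nabla u^{n+1}\right)-\frac{\{u^{n+1}\}^-}{\kappa}=\frac1\ell\int_{n\ell}^{(n+1)\ell}\tilde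 a(t)\,dt\quad\text{in }W^{-1,p'}(\Omega)=\left(W_0^{1,p}(\Omega)\right)^*,$$ that is, for all $v\in W_0^{1,p}(\Omega)$, $$\frac1\ell\int_\Omega\left(|u^{n+1}|^{\alpha-2}u^{n+1}-|u^n|^{\alpha-2}u^n\right)v\,dx+\int_\Omega\mu|\nabla u^{n+1}|^{p-2}\nabla u^{n+1}\cdot\nabla v\,dx-\frac1\kappa\int_\Omega\{u^{n+1}\}^-v\,dx=\int_\Omega\left(\frac1\ell\int_{n\ell}^{(n+1)\ell}\tilde a(t)\,dt\right)v\,dx .$$ Then for every $0\le n\le N-1$ and every $u^n\in W_0^{1,p}(\Omega)$, problem $\mathcal P_\kappa^{n+1}$ has exactly one solution $u^{n+1}\in W_0^{1,p}(\Omega)$. In particular, for every $u_0\in K$ there is exactly one sequence $(u^0,u^1,\dots,u^N)$ in $W_0^{1,p}(\Omega)$ with $u^0=u_0$ such that $u^{n+1}$ solves $\mathcal P_\kappa^{n+1}$ for the given $u^n$, for every $0\le n\le N-1$. -/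

import Mathlib

open MeasureTheory Set Filter Topology TopologicalSpace
open scoped NNReal ENNReal Distributions BoundedContinuousFunction

namespace IceSheet

noncomputable section

/-- The Euclidean plane. -/
abbrev Plane : Type := EuclideanSpace ℝ (Fin 2)

/-- A domain in the plane: a bounded connected open set whose boundary is Lipschitz-continuous,
the set being locally on one side of its boundary (near each boundary point, in suitable
orthonormal coordinates, it is the strict epigraph of a Lipschitz function). -/
structure IsLipschitzDomain (Ω : Opens Plane) : Prop where
  isBounded : Bornology.IsBounded (Ω : Set Plane)
  isConnected : IsConnected (Ω : Set Plane)
  lipschitz_boundary : ∀ x ∈ frontier (Ω : Set Plane),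
    ∃ (r : ℝ) (e : Plane ≃ₗᵢ[ℝ] Plane) (K : ℝ≥0) (γ : ℝ → ℝ),
      0 < r ∧ LipschitzWith K γ ∧ ∀ y ∈ Metric.ball x r, y ∈ Ω ↔ γ (e y 0) < e y 1

/-- `G` is a weak gradient of `u` in `Ω`. -/
def HasWeakGradient (Ω : Opens Plane) (u : Plane → ℝ) (G : Plane → Plane) : Prop :=
  ∀ φ : 𝓓(Ω, ℝ), ∫ x in Ω, u x • gradient φ x = -∫ x in Ω, φ x • G x

lemma continuous_gradient {Ω : Opens Plane} (φ : 𝓓(Ω, ℝ)) : Continuous (gradient φ) :=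
  (InnerProductSpace.toDual ℝ Plane).symm.continuous.comp
    (φ.contDiff.continuous_fderiv (by simp))

lemma hasCompactSupport_gradient {Ω : Opens Plane} (φ : 𝓓(Ω, ℝ)) :
    HasCompactSupport (gradient φ) :=
  (φ.hasCompactSupport.fderiv ℝ).comp_left
    (g := (InnerProductSpace.toDual ℝ Plane).symm) (map_zero _)

section

variable (Ω : Opens Plane) (q : ℝ≥0∞) [hq : Fact (1 ≤ q)]

/-- The Lebesgue space `L^q(Ω)`. -/
abbrev LpScalar : Type := Lp ℝ q (volume.restrict (Ω : Set Plane))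

/-- The Lebesgue space `L^q(Ω; ℝ²)`. -/
abbrev LpVector : Type := Lp Plane q (volume.restrict (Ω : Set Plane))

variable {Ω q}

lemma integrable_smul_gradient (u : LpScalar Ω q) (φ : 𝓓(Ω, ℝ)) :
    Integrable (fun x => u x • gradient φ x) (volume.restrict (Ω : Set Plane)) :=
  ((Lp.memLp u).locallyIntegrable hq.out).integrable_smul_right_of_hasCompactSupport
    (continuous_gradient φ) (hasCompactSupport_gradient φ)

lemma integrable_testFunction_smul (G : LpVector Ω q) (φ : 𝓓(Ω, ℝ)) :
    Integrable (fun x => φ x • G x) (volume.restrict (Ω : Set Plane)) :=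
  ((Lp.memLp G).locallyIntegrable hq.out).integrable_smul_left_of_hasCompactSupport
    φ.continuous φ.hasCompactSupport

variable (Ω q)

/-- The Sobolev space `W^{1,q}(Ω)`: the functions `u ∈ L^q(Ω)` with a weak gradient in `L^q(Ω; ℝ²)`.
An element is stored as the pair `(u, ∇u)` (the second component is determined by the first,
see `SobolevW.ext`), and the norm is the norm of that pair, a standard norm of `W^{1,q}(Ω)`
up to equivalence. -/
def SobolevW : Submodule ℝ (LpScalar Ω q × LpVector Ω q) where
  carrier := {w | HasWeakGradient Ω w.1 w.2}
  zero_mem' := by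
    intro φ
    have h1 : ∀ᵐ x ∂(volume.restrict (Ω : Set Plane)),
        ((0 : LpScalar Ω q) x) • gradient φ x = 0 := by
      filter_upwards [Lp.coeFn_zero ℝ q (volume.restrict (Ω : Set Plane))] with x hx
      rw [hx, Pi.zero_apply, zero_smul]
    have h2 : ∀ᵐ x ∂(volume.restrict (Ω : Set Plane)), φ x • ((0 : LpVector Ω q) x) = 0 := by
      filter_upwards [Lp.coeFn_zero Plane q (volume.restrict (Ω : Set Plane))] with x hx
      rw [hx, Pi.zero_apply, smul_zero]
    simp only [Prod.fst_zero, Prod.snd_zero]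
    rw [integral_congr_ae h1, integral_congr_ae h2]
    simp
  add_mem' := by
    intro w w' hw hw' φ
    have h1 : ∀ᵐ x ∂(volume.restrict (Ω : Set Plane)),
        ((w.1 + w'.1 : LpScalar Ω q) x) • gradient φ x
          = w.1 x • gradient φ x + w'.1 x • gradient φ x := by
      filter_upwards [Lp.coeFn_add w.1 w'.1] with x hx
      rw [hx, Pi.add_apply, add_smul]
    have h2 : ∀ᵐ x ∂(volume.restrict (Ω : Set Plane)),
        φ x • ((w.2 + w'.2 : LpVector Ω q) x) = φ x • w.2 x + φ x • w'.2 x := by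
      filter_upwards [Lp.coeFn_add w.2 w'.2] with x hx
      rw [hx, Pi.add_apply, smul_add]
    simp only [Prod.fst_add, Prod.snd_add]
    rw [integral_congr_ae h1, integral_congr_ae h2,
      integral_add (integrable_smul_gradient _ φ) (integrable_smul_gradient _ φ),
      integral_add (integrable_testFunction_smul _ φ) (integrable_testFunction_smul _ φ),
      hw φ, hw' φ, neg_add]
  smul_mem' := by
    intro c w hw φ
    have h1 : ∀ᵐ x ∂(volume.restrict (Ω : Set Plane)),
        ((c • w.1 : LpScalar Ω q) x) • gradient φ x = c • (w.1 x • gradient φ x) := by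
      filter_upwards [Lp.coeFn_smul c w.1] with x hx
      rw [hx, Pi.smul_apply, smul_eq_mul, mul_smul]
    have h2 : ∀ᵐ x ∂(volume.restrict (Ω : Set Plane)),
        φ x • ((c • w.2 : LpVector Ω q) x) = c • (φ x • w.2 x) := by
      filter_upwards [Lp.coeFn_smul c w.2] with x hx
      rw [hx, Pi.smul_apply, smul_comm c (φ x)]
    simp only [Prod.smul_fst, Prod.smul_snd]
    rw [integral_congr_ae h1, integral_congr_ae h2, integral_smul, integral_smul, hw φ, smul_neg]

variable {Ω q}

/-- An element of `W^{1,q}(Ω)` is determined by its underlying `L^q` function. -/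
lemma SobolevW.ext {w w' : SobolevW Ω q} (h : w.1.1 = w'.1.1) : w = w' := by
  refine Subtype.ext (Prod.ext h ?_)
  apply Lp.ext
  have hloc : ∀ G : LpVector Ω q, LocallyIntegrableOn G (Ω : Set Plane) volume := fun G =>
    locallyIntegrableOn_of_locallyIntegrable_restrict
      ((Lp.memLp G).locallyIntegrable Fact.out)
  have key := Ω.isOpen.ae_eq_zero_of_integral_contDiff_smul_eq_zero
    (f := fun x => w.1.2 x - w'.1.2 x) ((hloc _).sub (hloc _)) ?_
  · rw [Filter.EventuallyEq, ae_restrict_iff' Ω.isOpen.measurableSet]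
    filter_upwards [key] with x hx hxΩ
    exact sub_eq_zero.mp (hx hxΩ)
  · intro g g1 g2 g3
    let φ : 𝓓(Ω, ℝ) := ⟨g, g1, g2, g3⟩
    have e1 : ∫ x in Ω, φ x • w.1.2 x = ∫ x in Ω, φ x • w'.1.2 x := by
      have a := w.2 φ
      have b := w'.2 φ
      rw [h] at a
      exact neg_injective (a.symm.trans b)
    have e2 : ∫ x in Ω, φ x • (w.1.2 x - w'.1.2 x) = 0 := by
      simp only [smul_sub]
      rw [integral_sub (integrable_testFunction_smul _ φ) (integrable_testFunction_smul _ φ), e1,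
        sub_self]
    rw [← e2, setIntegral_eq_integral_of_forall_compl_eq_zero]
    · rfl
    · intro x hx
      have : φ x = 0 := image_eq_zero_of_notMem_tsupport fun h' => hx (g3 h')
      simp [this]

variable (Ω q)

/-- The test functions `𝓓(Ω)`, as a subspace of `W^{1,q}(Ω)`. -/
def testSubmodule : Submodule ℝ (SobolevW Ω q) where
  carrier := {w | ∃ φ : 𝓓(Ω, ℝ), w.1.1 =ᵐ[volume.restrict (Ω : Set Plane)] φ ∧
    w.1.2 =ᵐ[volume.restrict (Ω : Set Plane)] gradient φ}
  zero_mem' := by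
    refine ⟨0, ?_, ?_⟩
    · exact Lp.coeFn_zero ℝ q _
    · refine (Lp.coeFn_zero Plane q _).trans (Eventually.of_forall fun x => ?_)
      simp [gradient]
  add_mem' := by
    rintro w w' ⟨φ, h1, h2⟩ ⟨ψ, h3, h4⟩
    refine ⟨φ + ψ, ?_, ?_⟩
    · filter_upwards [Lp.coeFn_add w.1.1 w'.1.1, h1, h3] with x hx a b
      simpa [a, b] using hx
    · filter_upwards [Lp.coeFn_add w.1.2 w'.1.2, h2, h4] with x hx a b
      have e : gradient (⇑(φ + ψ)) x = gradient φ x + gradient ψ x := by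
        have := fderiv_add (𝕜 := ℝ) (x := x) (φ.contDiff.differentiable (by simp) x)
          (ψ.contDiff.differentiable (by simp) x)
        simp only [gradient, FunLike.coe_add, this, map_add]
      rw [e, ← a, ← b]
      exact hx
  smul_mem' := by
    rintro c w ⟨φ, h1, h2⟩
    refine ⟨c • φ, ?_, ?_⟩
    · filter_upwards [Lp.coeFn_smul c w.1.1, h1] with x hx a
      simpa [a] using hx
    · filter_upwards [Lp.coeFn_smul c w.1.2, h2] with x hx a
      have e : gradient (⇑(c • φ)) x = c • gradient φ x := by
        have := fderiv_const_smul (𝕜 := ℝ) (x := x) (φ.contDiff.differentiable (by simp) x) c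
        simp only [gradient, FunLike.coe_smul, this, map_smul]
      rw [e, ← a]
      exact hx

/-- The Sobolev space `W₀^{1,q}(Ω)`: the closure of `𝓓(Ω)` in `W^{1,q}(Ω)`. -/
def SobolevW0 : Submodule ℝ (SobolevW Ω q) := (testSubmodule Ω q).topologicalClosure

variable {Ω q}

/-- The function underlying an element of `W₀^{1,q}(Ω)`. -/
def toFn (u : SobolevW0 Ω q) : Plane → ℝ := u.1.1.1

/-- The weak gradient of an element of `W₀^{1,q}(Ω)`. -/
def weakGrad (u : SobolevW0 Ω q) : Plane → Plane := u.1.1.2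

variable (Ω q)

/-- The set `K` of the nonnegative elements of `W₀^{1,q}(Ω)`. -/
def nonnegCone : Set (SobolevW0 Ω q) :=
  {u | ∀ᵐ x ∂(volume.restrict (Ω : Set Plane)), 0 ≤ toFn u x}

end

/-- The space `C⁰(closure Ω)` with the sup norm (for bounded `Ω` every continuous function on
`closure Ω` is bounded). -/
abbrev ContClosure (Ω : Opens Plane) : Type := (closure (Ω : Set Plane)) →ᵇ ℝ

/-- `f ∈ W^{1,q}(0,T;X)`: both `f` and a weak derivative of `f` belong to `L^q(0,T;X)`. -/
def MemTimeSobolev {X : Type*} [NormedAddCommGroup X] [NormedSpace ℝ X]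
    (q : ℝ≥0∞) (T : ℝ) (f : ℝ → X) : Prop :=
  MemLp f q (volume.restrict (Ioo 0 T)) ∧
    ∃ f' : ℝ → X, MemLp f' q (volume.restrict (Ioo 0 T)) ∧
      ∀ φ : 𝓓((⟨Ioo 0 T, isOpen_Ioo⟩ : Opens ℝ), ℝ),
        ∫ t in Ioo 0 T, deriv φ t • f t = -∫ t in Ioo 0 T, φ t • f' t

/-- The exponent `α = (3p - 1) / (2p)`. -/
def alpha (p : ℝ) : ℝ := (3 * p - 1) / (2 * p)

/-- The negative part `{s}⁻ = (|s| - s) / 2` of a real number. -/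
def negativePart (s : ℝ) : ℝ := (|s| - s) / 2

/-- The time average `(1/ℓ) ∫_{nℓ}^{(n+1)ℓ} ã(t) dt`, a Bochner integral in `C⁰(closure Ω)`. -/
def sourceMean {Ω : Opens Plane} (a : ℝ → ContClosure Ω) (ℓ : ℝ) (n : ℕ) : ContClosure Ω :=
  (1 / ℓ) • ∫ t in (n * ℓ)..((n + 1) * ℓ), a t

/-- A continuous function on `closure Ω`, extended by zero to the plane. -/
def extendZero {Ω : Opens Plane} (f : ContClosure Ω) : Plane → ℝ :=
  Function.extend Subtype.val f 0

/-- `uNext` solves the semi-discrete penalized problem with index `n + 1` for the previous iterate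
`uPrev`: the identity
`(1/ℓ) (|uNext|^(α-2) uNext - |uPrev|^(α-2) uPrev) - div (μ |∇uNext|^(p-2) ∇uNext) - {uNext}⁻ / κ
  = (1/ℓ) ∫_{nℓ}^{(n+1)ℓ} ã(t) dt`
holds in the dual of `W₀^{1,p}(Ω)`, that is, when evaluated at every `v` in that space. -/
def IsStepSolution {Ω : Opens Plane} {p : ℝ} [Fact (1 ≤ ENNReal.ofReal p)]
    (κ ℓ : ℝ) (μ : Plane → ℝ) (a : ℝ → ContClosure Ω) (n : ℕ)
    (uPrev uNext : SobolevW0 Ω (ENNReal.ofReal p)) : Prop :=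
  ∀ v : SobolevW0 Ω (ENNReal.ofReal p),
    (1 / ℓ) * (∫ x in Ω, (|toFn uNext x| ^ (alpha p - 2) * toFn uNext x
        - |toFn uPrev x| ^ (alpha p - 2) * toFn uPrev x) * toFn v x)
      + (∫ x in Ω, μ x * inner ℝ (‖weakGrad uNext x‖ ^ (p - 2) • weakGrad uNext x) (weakGrad v x))
      - (1 / κ) * (∫ x in Ω, negativePart (toFn uNext x) * toFn v x)
    = ∫ x in Ω, extendZero (sourceMean a ℓ n) x * toFn v x

end

end IceSheet

open IceSheet

/-!
The solutions of one step of the scheme are the critical points of a convex functional: up to a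
linear term it is the sum of the `p`-energy of the gradient and of the integrals of `|u|^α / (αℓ)`
and of the square of the negative part of `u`. By Clarkson's inequality the `p`-energy lies above
its tangents by a multiple of the `p`-th power of the `L^p` distance of the gradients, which
Friedrichs' inequality turns into a distance in `W₀^{1,p}`. This uniform convexity makes minimizing
sequences Cauchy, so that no weak compactness is needed for existence, and separates any two
critical points.
-/

namespace IceSheet

section ConvexFunctional

variable {X Y : Type*} [NormedAddCommGroup X] [NormedSpace ℝ X]
  [NormedAddCommGroup Y] [NormedSpace ℝ Y]

/-- `J` is a convex functional with hemicontinuous Gâteaux derivative `A`, uniformly convex of power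
type `p` with modulus `c` (plain convexity for `c = 0`). Convexity is encoded by the gradient
inequality, which also determines `A` from `J`. -/
structure ConvexFunctional (p c : ℝ) (J : X → ℝ) (A : X → X →L[ℝ] ℝ) : Prop where
  modulus_nonneg : 0 ≤ c
  subgradient_le : ∀ u w, J u + A u (w - u) + c * ‖w - u‖ ^ p ≤ J w
  hemicontinuous : ∀ u v, ContinuousAt (fun t : ℝ => A (u + t • v) v) 0

namespace ConvexFunctional

variable {p c c' k m : ℝ} {J J' : X → ℝ} {A A' : X → X →L[ℝ] ℝ}

lemma add (h : ConvexFunctional p c J A) (h' : ConvexFunctional p c' J' A') :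
    ConvexFunctional p (c + c') (fun u => J u + J' u) (fun u => A u + A' u) where
  modulus_nonneg := add_nonneg h.modulus_nonneg h'.modulus_nonneg
  subgradient_le u w := by
    simp only [add_apply, add_mul]
    linarith [h.subgradient_le u w, h'.subgradient_le u w]
  hemicontinuous u v := (h.hemicontinuous u v).add (h'.hemicontinuous u v)

lemma sub_clm (h : ConvexFunctional p c J A) (F : X →L[ℝ] ℝ) :
    ConvexFunctional p c (fun u => J u - F u) (fun u => A u - F) where
  modulus_nonneg := h.modulus_nonneg
  subgradient_le u w := by
    simp only [sub_apply, map_sub F]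
    linarith [h.subgradient_le u w]
  hemicontinuous u v := (h.hemicontinuous u v).sub continuousAt_const

lemma comp {J : Y → ℝ} {A : Y → Y →L[ℝ] ℝ} (h : ConvexFunctional p c J A) (hp : 0 ≤ p)
    (D : X →L[ℝ] Y) (hk : 0 ≤ k) (hD : ∀ u, k * ‖u‖ ≤ ‖D u‖) :
    ConvexFunctional p (c * k ^ p) (fun u => J (D u)) (fun u => (A (D u)).comp D) where
  modulus_nonneg := mul_nonneg h.modulus_nonneg (by positivity)
  subgradient_le u w := by
    have hnorm : k ^ p * ‖w - u‖ ^ p ≤ ‖D w - D u‖ ^ p := by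
      rw [← Real.mul_rpow hk (norm_nonneg _), ← map_sub]
      exact Real.rpow_le_rpow (by positivity) (hD _) hp
    have := mul_le_mul_of_nonneg_left hnorm h.modulus_nonneg
    rw [ContinuousLinearMap.comp_apply, map_sub]
    linarith [h.subgradient_le (D u) (D w)]
  hemicontinuous u v := by
    simpa only [ContinuousLinearMap.comp_apply, map_add, map_smul]
      using h.hemicontinuous (D u) (D v)

lemma bddBelow_range (h : ConvexFunctional p c J A) (hc : 0 < c) (hp : 1 < p) :
    BddBelow (range J) := by
  set ε : ℝ := (c * p) ^ p⁻¹
  set q : ℝ := p.conjExponent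
  have hε : 0 < ε := by positivity
  refine ⟨J 0 - (‖A 0‖ / ε) ^ q / q, ?_⟩
  rintro _ ⟨w, rfl⟩
  have young : ‖A 0‖ * ‖w‖ ≤ c * ‖w‖ ^ p + (‖A 0‖ / ε) ^ q / q := by
    calc ‖A 0‖ * ‖w‖ = (ε * ‖w‖) * (‖A 0‖ / ε) := by field_simp
      _ ≤ (ε * ‖w‖) ^ p / p + (‖A 0‖ / ε) ^ q / q :=
        Real.young_inequality_of_nonneg (by positivity) (by positivity) (.conjExponent hp)
      _ = c * ‖w‖ ^ p + (‖A 0‖ / ε) ^ q / q := by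
        rw [Real.mul_rpow hε.le (norm_nonneg _), Real.rpow_inv_rpow (by positivity) (by positivity)]
        field_simp
  have hlin : -(‖A 0‖ * ‖w‖) ≤ A 0 w := (abs_le.1 ((A 0).le_opNorm w)).1
  have := h.subgradient_le 0 w
  rw [sub_zero] at this
  linarith

/-- Comparing `J` at `u` and at `w` with its value at their midpoint. -/
lemma dist_le_of_forall_le (h : ConvexFunctional p c J A) (hc : 0 < c) (hp : 0 < p)
    (hm : ∀ u, m ≤ J u) (u w : X) :
    dist u w ≤ 2 * ((J u + J w - 2 * m) / (2 * c)) ^ p⁻¹ := by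
  set z : X := (1 / 2 : ℝ) • (u + w)
  set d : X := (1 / 2 : ℝ) • (u - w)
  have hu : u - z = d := by module
  have hw : w - z = -d := by module
  have hzu := h.subgradient_le z u
  have hzw := h.subgradient_le z w
  rw [hu] at hzu
  rw [hw, norm_neg, map_neg] at hzw
  have hd : ‖d‖ ^ p ≤ (J u + J w - 2 * m) / (2 * c) := by
    rw [le_div_iff₀ (by positivity)]
    linarith [hm z]
  have hdist : dist u w = 2 * ‖d‖ := by
    rw [dist_eq_norm, norm_smul, Real.norm_of_nonneg (by norm_num)]
    ring
  rw [hdist]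
  gcongr
  rwa [Real.le_rpow_inv_iff_of_pos (norm_nonneg _) ((by positivity : 0 ≤ ‖d‖ ^ p).trans hd) hp]

lemma cauchySeq_of_tendsto (h : ConvexFunctional p c J A) (hc : 0 < c) (hp : 0 < p)
    (hm : ∀ u, m ≤ J u) {s : ℕ → X} (hs : Tendsto (J ∘ s) atTop (𝓝 m)) : CauchySeq s := by
  rw [cauchySeq_iff_tendsto_dist_atTop_0]
  refine squeeze_zero (fun _ => dist_nonneg) (fun n => h.dist_le_of_forall_le hc hp hm _ _) ?_
  have hfst : Tendsto (fun n : ℕ × ℕ => J (s n.1)) atTop (𝓝 m) :=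
    hs.comp (prod_atTop_atTop_eq (α := ℕ) (β := ℕ) ▸ tendsto_fst)
  have hsnd : Tendsto (fun n : ℕ × ℕ => J (s n.2)) atTop (𝓝 m) :=
    hs.comp (prod_atTop_atTop_eq (α := ℕ) (β := ℕ) ▸ tendsto_snd)
  have hlim := (((((hfst.add hsnd).sub_const (2 * m)).div_const (2 * c)).rpow_const
    (p := p⁻¹) (.inr (by positivity))).const_mul 2)
  rwa [← two_mul, sub_self, zero_div, Real.zero_rpow (by positivity), mul_zero] at hlim

lemma le_of_tendsto (h : ConvexFunctional p c J A) {s : ℕ → X} {u : X}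
    (hs : Tendsto s atTop (𝓝 u)) (hJs : Tendsto (J ∘ s) atTop (𝓝 m)) : J u ≤ m := by
  have hA : Tendsto (fun n => A u (s n - u)) atTop (𝓝 0) := by
    have := ((A u).continuous.tendsto _).comp (hs.sub_const u)
    rwa [sub_self, map_zero] at this
  have hJA : Tendsto (fun n => J (s n) - A u (s n - u)) atTop (𝓝 m) := by
    have := hJs.sub hA
    rwa [sub_zero] at this
  refine ge_of_tendsto' hJA fun n => ?_
  have : 0 ≤ c * ‖s n - u‖ ^ p := mul_nonneg h.modulus_nonneg (by positivity)
  linarith [h.subgradient_le u (s n)]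

lemma exists_forall_le [CompleteSpace X] (h : ConvexFunctional p c J A) (hc : 0 < c)
    (hp : 1 < p) : ∃ u, ∀ w, J u ≤ J w := by
  have hbdd := h.bddBelow_range hc hp
  have hm : ∀ u, sInf (range J) ≤ J u := fun u => csInf_le hbdd (mem_range_self u)
  obtain ⟨y, -, hy, hymem⟩ := exists_seq_tendsto_sInf (range_nonempty J) hbdd
  choose s hs using hymem
  obtain rfl : J ∘ s = y := funext hs
  obtain ⟨u, hu⟩ :=
    cauchySeq_tendsto_of_complete (h.cauchySeq_of_tendsto hc (by linarith) hm hy)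
  exact ⟨u, fun w => (h.le_of_tendsto hu hy).trans (hm w)⟩

lemma eq_zero_of_forall_le (h : ConvexFunctional p c J A) {u : X} (hu : ∀ w, J u ≤ J w) :
    A u = 0 := by
  have hnonneg : ∀ v, 0 ≤ A u v := fun v => by
    have hlim := (h.hemicontinuous u v).continuousWithinAt (s := Ioi 0)
    simp only [ContinuousWithinAt, zero_smul, add_zero] at hlim
    refine ge_of_tendsto hlim ?_
    filter_upwards [self_mem_nhdsWithin] with t ht
    have hsub := h.subgradient_le (u + t • v) u
    rw [sub_add_cancel_left, map_neg, map_smul, smul_eq_mul] at hsub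
    have hc : 0 ≤ c * ‖-(t • v)‖ ^ p := mul_nonneg h.modulus_nonneg (by positivity)
    exact nonneg_of_mul_nonneg_right (by linarith [hu (u + t • v)]) (mem_Ioi.1 ht)
  ext v
  have := hnonneg (-v)
  rw [map_neg] at this
  rw [zero_apply]
  linarith [hnonneg v]

lemma eq_of_eq_zero (h : ConvexFunctional p c J A) (hc : 0 < c) (hp : p ≠ 0) {u w : X}
    (hu : A u = 0) (hw : A w = 0) : u = w := by
  have huw := h.subgradient_le u w
  have hwu := h.subgradient_le w u
  rw [hu, zero_apply] at huw
  rw [hw, zero_apply, norm_sub_rev] at hwu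
  have hle : ‖w - u‖ ^ p ≤ 0 := nonpos_of_mul_nonpos_right (by linarith) hc
  have hzero := le_antisymm hle (by positivity)
  rw [Real.rpow_eq_zero (norm_nonneg _) hp, norm_eq_zero, sub_eq_zero] at hzero
  exact hzero.symm

theorem existsUnique_eq_zero [CompleteSpace X] (h : ConvexFunctional p c J A) (hc : 0 < c)
    (hp : 1 < p) : ∃! u, A u = 0 := by
  obtain ⟨u, hu⟩ := h.exists_forall_le hc hp
  exact ⟨u, h.eq_zero_of_forall_le hu,
    fun w hw => h.eq_of_eq_zero hc (by linarith) hw (h.eq_zero_of_forall_le hu)⟩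

end ConvexFunctional

end ConvexFunctional

section ConvexPotential

variable {E : Type*} [NormedAddCommGroup E] [InnerProductSpace ℝ E]

/-- `B` is a convex function with continuous gradient `b` of growth `p - 1`, uniformly convex of
power type `p` with modulus `c` (plain convexity for `c = 0`): the integrands `B` for which
`u ↦ ∫ B(u)` is a `ConvexFunctional` on `L^p`. -/
structure ConvexPotential (p c : ℝ) (B : E → ℝ) (b : E → E) : Prop where
  modulus_nonneg : 0 ≤ c
  continuous_flux : Continuous b
  exists_norm_flux_le : ∃ K, ∀ ξ, ‖b ξ‖ ≤ K * (1 + ‖ξ‖) ^ (p - 1)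
  subgradient_le : ∀ ξ η, B ξ + inner ℝ (b ξ) (η - ξ) + c * ‖η - ξ‖ ^ p ≤ B η

namespace ConvexPotential

variable {p c c' r : ℝ} {B B' : E → ℝ} {b b' : E → E}

lemma add (h : ConvexPotential p c B b) (h' : ConvexPotential p c' B' b') :
    ConvexPotential p (c + c') (fun ξ => B ξ + B' ξ) (fun ξ => b ξ + b' ξ) where
  modulus_nonneg := add_nonneg h.modulus_nonneg h'.modulus_nonneg
  continuous_flux := h.continuous_flux.add h'.continuous_flux
  exists_norm_flux_le := by
    obtain ⟨K, hK⟩ := h.exists_norm_flux_le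
    obtain ⟨K', hK'⟩ := h'.exists_norm_flux_le
    refine ⟨K + K', fun ξ => (norm_add_le _ _).trans ?_⟩
    linarith [hK ξ, hK' ξ]
  subgradient_le ξ η := by
    rw [inner_add_left]
    linarith [h.subgradient_le ξ η, h'.subgradient_le ξ η]

lemma const_mul (h : ConvexPotential p c B b) (hr : 0 ≤ r) :
    ConvexPotential p (r * c) (fun ξ => r * B ξ) (fun ξ => r • b ξ) where
  modulus_nonneg := mul_nonneg hr h.modulus_nonneg
  continuous_flux := h.continuous_flux.const_smul r
  exists_norm_flux_le := by
    obtain ⟨K, hK⟩ := h.exists_norm_flux_le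
    refine ⟨r * K, fun ξ => ?_⟩
    rw [norm_smul, Real.norm_of_nonneg hr, mul_assoc]
    exact mul_le_mul_of_nonneg_left (hK ξ) hr
  subgradient_le ξ η := by
    rw [real_inner_smul_left]
    linarith [mul_le_mul_of_nonneg_left (h.subgradient_le ξ η) hr]

lemma sub_le (h : ConvexPotential p c B b) (ξ η : E) : B ξ - B η ≤ ‖b ξ‖ * ‖ξ - η‖ := by
  have hinner := real_inner_le_norm (b ξ) (ξ - η)
  have hneg : inner ℝ (b ξ) (η - ξ) = -inner ℝ (b ξ) (ξ - η) := by
    rw [← inner_neg_right, neg_sub]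
  have : 0 ≤ c * ‖η - ξ‖ ^ p := mul_nonneg h.modulus_nonneg (by positivity)
  linarith [h.subgradient_le ξ η]

lemma abs_sub_le (h : ConvexPotential p c B b) (ξ η : E) :
    |B ξ - B η| ≤ (‖b ξ‖ + ‖b η‖) * ‖ξ - η‖ := by
  have hη := h.sub_le η ξ
  rw [norm_sub_rev] at hη
  have := mul_nonneg (norm_nonneg (b ξ)) (norm_nonneg (ξ - η))
  have := mul_nonneg (norm_nonneg (b η)) (norm_nonneg (ξ - η))
  rw [abs_le]
  constructor <;> linarith [h.sub_le ξ η]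

lemma continuous (h : ConvexPotential p c B b) : Continuous B := by
  rw [continuous_iff_continuousAt]
  refine fun η => tendsto_iff_dist_tendsto_zero.2 (squeeze_zero (fun _ => dist_nonneg)
    (fun ξ => h.abs_sub_le ξ η) ?_)
  have hb := h.continuous_flux
  have hbound : Continuous fun ξ => (‖b ξ‖ + ‖b η‖) * ‖ξ - η‖ := by fun_prop
  simpa using hbound.tendsto η

lemma exists_norm_flux_add_smul_le (hB : ConvexPotential p c B b) (hp : 1 < p) :
    ∃ K, ∀ ξ η, ∀ t : ℝ, ‖t‖ ≤ 1 →
      ‖b (ξ + t • η)‖ ≤ K * (1 + ‖‖ξ‖ + ‖η‖‖) ^ (p - 1) := by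
  obtain ⟨K, hK⟩ := hB.exists_norm_flux_le
  have hK₀ : 0 ≤ K := (norm_nonneg (b 0)).trans (by simpa using hK 0)
  refine ⟨K, fun ξ η t ht => (hK _).trans ?_⟩
  have hnorm : ‖ξ + t • η‖ ≤ ‖‖ξ‖ + ‖η‖‖ := by
    refine (norm_add_le_of_le le_rfl ?_).trans (Real.le_norm_self _)
    rw [norm_smul]
    exact mul_le_of_le_one_left (norm_nonneg _) ht
  have : 0 ≤ p - 1 := by linarith
  gcongr

end ConvexPotential

/-- The gradient `‖ξ‖ ^ (q - 2) • ξ` of `‖ξ‖ ^ q / q`. At `ξ = 0` it vanishes, whatever the value of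
the power there. -/
noncomputable def powerFlux (q : ℝ) (ξ : E) : E := ‖ξ‖ ^ (q - 2) • ξ

section powerFlux

variable {p q : ℝ}

lemma norm_powerFlux (hq : q ≠ 1) (ξ : E) : ‖powerFlux q ξ‖ = ‖ξ‖ ^ (q - 1) := by
  rcases eq_or_ne ξ 0 with rfl | hξ
  · simp [powerFlux, Real.zero_rpow (sub_ne_zero.2 hq)]
  · rw [powerFlux, norm_smul, Real.norm_of_nonneg (by positivity),
      ← Real.rpow_add_one (norm_ne_zero_iff.2 hξ)]
    ring_nf

lemma inner_powerFlux_self (hq : q ≠ 0) (ξ : E) : inner ℝ (powerFlux q ξ) ξ = ‖ξ‖ ^ q := by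
  rcases eq_or_ne ξ 0 with rfl | hξ
  · simp [Real.zero_rpow hq]
  · rw [powerFlux, real_inner_smul_left, real_inner_self_eq_norm_sq, ← Real.rpow_natCast,
      ← Real.rpow_add (norm_pos_iff.2 hξ)]
    norm_num

lemma continuous_powerFlux (hq : 1 < q) : Continuous (powerFlux q : E → E) := by
  refine continuous_iff_continuousAt.2 fun ξ => ?_
  rcases eq_or_ne ξ 0 with rfl | hξ
  · have hnorm : Continuous fun ξ : E => ‖ξ‖ ^ (q - 1) :=
      continuous_norm.rpow_const fun _ => .inr (by linarith)
    have hzero : powerFlux q (0 : E) = 0 := smul_zero _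
    rw [ContinuousAt, hzero, tendsto_zero_iff_norm_tendsto_zero]
    simpa [norm_powerFlux hq.ne', Real.zero_rpow (by linarith : q - 1 ≠ 0)] using hnorm.tendsto 0
  · exact (continuous_norm.continuousAt.rpow_const (.inl (norm_ne_zero_iff.2 hξ))).smul
      continuousAt_id

lemma powerFlux_subgradient_le (hq : 1 < q) (ξ η : E) :
    ‖ξ‖ ^ q / q + inner ℝ (powerFlux q ξ) (η - ξ) ≤ ‖η‖ ^ q / q := by
  have hq' : q - 1 ≠ 0 := by linarith
  have young : ‖η‖ * ‖ξ‖ ^ (q - 1) ≤ ‖η‖ ^ q / q + ‖ξ‖ ^ q / (q / (q - 1)) := by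
    have := Real.young_inequality_of_nonneg (norm_nonneg η)
      (by positivity : 0 ≤ ‖ξ‖ ^ (q - 1)) (.conjExponent hq)
    rwa [Real.conjExponent, ← Real.rpow_mul (norm_nonneg _), mul_div_cancel₀ _ hq'] at this
  have hinner : inner ℝ (powerFlux q ξ) η ≤ ‖η‖ * ‖ξ‖ ^ (q - 1) := by
    rw [mul_comm, ← norm_powerFlux hq.ne']
    exact real_inner_le_norm _ _
  have hconj : ‖ξ‖ ^ q / (q / (q - 1)) = ‖ξ‖ ^ q - ‖ξ‖ ^ q / q := by field_simp
  rw [inner_sub_right, inner_powerFlux_self (by linarith)]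
  linarith

lemma sq_rpow_half {x : ℝ} (hx : 0 ≤ x) (p : ℝ) : (x ^ 2) ^ (p / 2) = x ^ p := by
  rw [Real.rpow_div_two_eq_sqrt _ (sq_nonneg x), Real.sqrt_sq hx]

lemma norm_half_add_rpow_add_norm_half_sub_rpow_le (hp : 2 ≤ p) (ξ η : E) :
    ‖(1 / 2 : ℝ) • (ξ + η)‖ ^ p + ‖(1 / 2 : ℝ) • (η - ξ)‖ ^ p ≤ (‖ξ‖ ^ p + ‖η‖ ^ p) / 2 := by
  set x := ‖(1 / 2 : ℝ) • (ξ + η)‖ with hx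
  set y := ‖(1 / 2 : ℝ) • (η - ξ)‖ with hy
  have parallelogram : x ^ 2 + y ^ 2 = 1 / 2 * ‖ξ‖ ^ 2 + 1 / 2 * ‖η‖ ^ 2 := by
    rw [hx, hy, norm_smul, norm_smul, Real.norm_of_nonneg (by norm_num), add_comm ξ η]
    linarith [parallelogram_law_with_norm ℝ η ξ]
  have convexity := (convexOn_rpow (by linarith : 1 ≤ p / 2)).2
    (mem_Ici.2 (sq_nonneg ‖ξ‖)) (mem_Ici.2 (sq_nonneg ‖η‖))
    (by norm_num : (0 : ℝ) ≤ 1 / 2) (by norm_num : (0 : ℝ) ≤ 1 / 2) (by norm_num)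
  simp only [smul_eq_mul, sq_rpow_half (norm_nonneg _)] at convexity
  calc x ^ p + y ^ p = (x ^ 2) ^ (p / 2) + (y ^ 2) ^ (p / 2) := by
        rw [sq_rpow_half (norm_nonneg _), sq_rpow_half (norm_nonneg _)]
    _ ≤ (x ^ 2 + y ^ 2) ^ (p / 2) :=
        Real.add_rpow_le_rpow_add (by positivity) (by positivity) (by linarith)
    _ ≤ 1 / 2 * ‖ξ‖ ^ p + 1 / 2 * ‖η‖ ^ p := by rwa [parallelogram]
    _ = (‖ξ‖ ^ p + ‖η‖ ^ p) / 2 := by ring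

/-- The gradient inequality between `ξ` and the midpoint of `ξ` and `η`, combined with Clarkson's
inequality. -/
lemma powerFlux_uniform_subgradient_le (hp : 2 ≤ p) (ξ η : E) :
    ‖ξ‖ ^ p / p + inner ℝ (powerFlux p ξ) (η - ξ) + 2 * (1 / 2) ^ p / p * ‖η - ξ‖ ^ p
      ≤ ‖η‖ ^ p / p := by
  have midpoint : ‖ξ‖ ^ p / p + 1 / 2 * inner ℝ (powerFlux p ξ) (η - ξ)
      ≤ ‖(1 / 2 : ℝ) • (ξ + η)‖ ^ p / p := by
    have hsub : (1 / 2 : ℝ) • (ξ + η) - ξ = (1 / 2 : ℝ) • (η - ξ) := by module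
    simpa only [hsub, inner_smul_right] using
      powerFlux_subgradient_le (by linarith : 1 < p) ξ ((1 / 2 : ℝ) • (ξ + η))
  have clarkson := div_le_div_of_nonneg_right
    (norm_half_add_rpow_add_norm_half_sub_rpow_le hp ξ η) (by linarith : 0 ≤ p)
  rw [norm_smul _ (η - ξ), Real.norm_of_nonneg (by norm_num),
    Real.mul_rpow (by norm_num) (norm_nonneg _)] at clarkson
  linear_combination 2 * midpoint + 2 * clarkson

lemma norm_powerFlux_le (hq : 1 < q) (hqp : q ≤ p) (ξ : E) :
    ‖powerFlux q ξ‖ ≤ (1 + ‖ξ‖) ^ (p - 1) := by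
  have hξ := norm_nonneg ξ
  calc ‖powerFlux q ξ‖ = ‖ξ‖ ^ (q - 1) := norm_powerFlux hq.ne' ξ
    _ ≤ (1 + ‖ξ‖) ^ (q - 1) := Real.rpow_le_rpow hξ (by linarith) (by linarith)
    _ ≤ (1 + ‖ξ‖) ^ (p - 1) := Real.rpow_le_rpow_of_exponent_le (by linarith) (by linarith)

lemma convexPotential_powerFlux (hq : 1 < q) (hqp : q ≤ p) :
    ConvexPotential p 0 (fun ξ : E => ‖ξ‖ ^ q / q) (powerFlux q) where
  modulus_nonneg := le_rfl
  continuous_flux := continuous_powerFlux hq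
  exists_norm_flux_le := ⟨1, by simpa only [one_mul] using norm_powerFlux_le hq hqp⟩
  subgradient_le ξ η := by simpa using powerFlux_subgradient_le hq ξ η

lemma uniformlyConvexPotential_powerFlux (hp : 2 ≤ p) :
    ConvexPotential p (2 * (1 / 2) ^ p / p) (fun ξ : E => ‖ξ‖ ^ p / p) (powerFlux p) where
  modulus_nonneg := by positivity
  continuous_flux := continuous_powerFlux (by linarith)
  exists_norm_flux_le :=
    ⟨1, by simpa only [one_mul] using norm_powerFlux_le (by linarith) le_rfl⟩
  subgradient_le := powerFlux_uniform_subgradient_le hp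

end powerFlux

lemma negativePart_nonneg (s : ℝ) : 0 ≤ negativePart s := by
  rw [negativePart]
  linarith [le_abs_self s]

lemma negativePart_le_abs (s : ℝ) : negativePart s ≤ |s| := by
  rw [negativePart]
  linarith [neg_abs_le s]

lemma negativePart_subgradient_le (s t : ℝ) :
    negativePart s ^ 2 / 2 - negativePart s * (t - s) ≤ negativePart t ^ 2 / 2 := by
  have hs : negativePart s * (negativePart s + s) = 0 := by
    rw [negativePart]
    linear_combination (sq_abs s) / 4
  have ht : -t ≤ negativePart t := by
    rw [negativePart]
    linarith [neg_abs_le t]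
  have := mul_le_mul_of_nonneg_left ht (negativePart_nonneg s)
  linarith [sq_nonneg (negativePart s - negativePart t)]

lemma convexPotential_neg_negativePart {p : ℝ} (hp : 2 ≤ p) :
    ConvexPotential p 0 (fun s : ℝ => negativePart s ^ 2 / 2) (fun s => -negativePart s) where
  modulus_nonneg := le_rfl
  continuous_flux := by
    unfold negativePart
    fun_prop
  exists_norm_flux_le := by
    refine ⟨1, fun s => ?_⟩
    have hs := norm_nonneg s
    rw [one_mul, norm_neg, Real.norm_of_nonneg (negativePart_nonneg s)]
    calc negativePart s ≤ 1 + ‖s‖ := by linarith [negativePart_le_abs s, Real.norm_eq_abs s]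
      _ ≤ (1 + ‖s‖) ^ (p - 1) := Real.self_le_rpow_of_one_le (by linarith) (by linarith)
  subgradient_le s t := by
    simpa [mul_comm, ← sub_eq_add_neg] using negativePart_subgradient_le s t

end ConvexPotential

instance fact_one_le_conjExponent (q : ℝ≥0∞) : Fact (1 ≤ q.conjExponent) := ⟨le_self_add⟩

section Pairing

variable {S E F G : Type*} [MeasurableSpace S] {ν : Measure S}
  [NormedAddCommGroup E] [NormedSpace ℝ E] [NormedAddCommGroup F] [NormedSpace ℝ F]
  [NormedAddCommGroup G] [NormedSpace ℝ G] [CompleteSpace G]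
  {q : ℝ≥0∞} [Fact (1 ≤ q)]

/-- The map `v ↦ ∫ L(g, v)` on `L^q` defined by a continuous bilinear map `L` and a function `g` of
the conjugate Lebesgue space. -/
noncomputable def lpIntegralCLM (L : F →L[ℝ] E →L[ℝ] G) {g : S → F}
    (hg : MemLp g q.conjExponent ν) : Lp E q ν →L[ℝ] G :=
  L.lpPairing ν q.conjExponent q (hg.toLp g)

lemma lpIntegralCLM_apply (L : F →L[ℝ] E →L[ℝ] G) {g : S → F} (hg : MemLp g q.conjExponent ν)
    (v : Lp E q ν) : lpIntegralCLM L hg v = ∫ x, L (g x) (v x) ∂ν := by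
  rw [lpIntegralCLM, ContinuousLinearMap.lpPairing_eq_integral]
  refine integral_congr_ae ?_
  filter_upwards [hg.coeFn_toLp] with x hx
  rw [hx]

end Pairing

section IntegralFunctional

variable {S E : Type*} [MeasurableSpace S] {ν : Measure S} [NormedAddCommGroup E] {p : ℝ}

lemma integrable_inner_of_memLp [InnerProductSpace ℝ E] {q : ℝ≥0∞} [Fact (1 ≤ q)]
    {g h : S → E} (hg : MemLp g q.conjExponent ν) (hh : MemLp h q ν) :
    Integrable (fun x => inner ℝ (g x) (h x)) ν :=
  memLp_one_iff_integrable.1 ((innerSL ℝ).memLp_of_bilin 1 hg hh)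

lemma integrable_norm_rpow_of_memLp (hp : 0 < p) {u : S → E} (hu : MemLp u (ENNReal.ofReal p) ν) :
    Integrable (fun x => ‖u x‖ ^ p) ν := by
  simpa only [ENNReal.toReal_ofReal hp.le] using
    hu.integrable_norm_rpow (ENNReal.ofReal_pos.2 hp).ne' ENNReal.ofReal_ne_top

lemma norm_rpow_eq_integral (hp : 0 < p) (u : Lp E (ENNReal.ofReal p) ν) :
    ‖u‖ ^ p = ∫ x, ‖u x‖ ^ p ∂ν := by
  have hnonneg : 0 ≤ ∫ x, ‖u x‖ ^ p ∂ν := integral_nonneg fun x => by positivity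
  rw [Lp.norm_def, (Lp.memLp u).eLpNorm_eq_integral_rpow_norm
    (ENNReal.ofReal_pos.2 hp).ne' ENNReal.ofReal_ne_top, ENNReal.toReal_ofReal hp.le,
    ENNReal.toReal_ofReal (by positivity), Real.rpow_inv_rpow hnonneg hp.ne']

lemma conjExponent_ofReal (hp : 1 < p) :
    (ENNReal.ofReal p).conjExponent = ENNReal.ofReal p / ENNReal.ofReal (p - 1) := by
  have := (Real.HolderConjugate.conjExponent hp).ennrealOfReal
  rw [ENNReal.HolderConjugate.conjExponent_eq (q := ENNReal.ofReal p.conjExponent),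
    Real.conjExponent, ENNReal.ofReal_div_of_pos (by linarith)]

lemma lpIntegralCLM_innerSL_apply [InnerProductSpace ℝ E] {q : ℝ≥0∞} [Fact (1 ≤ q)] {g : S → E}
    (hg : MemLp g q.conjExponent ν) (v : Lp E q ν) :
    lpIntegralCLM (innerSL ℝ) hg v = ∫ x, inner ℝ (g x) (v x) ∂ν :=
  lpIntegralCLM_apply _ hg v

variable [IsFiniteMeasure ν]

lemma memLp_one_add_norm_rpow (hp : 1 < p) {u : S → E}
    (hu : MemLp u (ENNReal.ofReal p) ν) :
    MemLp (fun x => (1 + ‖u x‖) ^ (p - 1)) (ENNReal.ofReal p).conjExponent ν := by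
  have hsum : MemLp (fun x => 1 + ‖u x‖) (ENNReal.ofReal p) ν := (memLp_const (1 : ℝ)).add hu.norm
  have hnorm : ∀ x, ‖1 + ‖u x‖‖ = 1 + ‖u x‖ := fun x => Real.norm_of_nonneg (by positivity)
  simpa only [conjExponent_ofReal hp, ENNReal.toReal_ofReal (by linarith : 0 ≤ p - 1), hnorm]
    using hsum.norm_rpow_div (ENNReal.ofReal (p - 1))

variable [InnerProductSpace ℝ E] {c w₁ : ℝ} {B : E → ℝ} {b : E → E} {w : S → ℝ}

namespace ConvexPotential

lemma memLp_flux (hB : ConvexPotential p c B b) (hp : 1 < p) {u : S → E}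
    (hu : MemLp u (ENNReal.ofReal p) ν) :
    MemLp (fun x => b (u x)) (ENNReal.ofReal p).conjExponent ν := by
  obtain ⟨K, hK⟩ := hB.exists_norm_flux_le
  refine (memLp_one_add_norm_rpow hp hu).of_le_mul (c := K)
    (hB.continuous_flux.comp_aestronglyMeasurable hu.1) (.of_forall fun x => ?_)
  rw [Real.norm_of_nonneg (by positivity)]
  exact hK (u x)

lemma memLp_smul_flux (hB : ConvexPotential p c B b) (hp : 1 < p) (hw : MemLp w ∞ ν) {u : S → E}
    (hu : MemLp u (ENNReal.ofReal p) ν) :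
    MemLp (fun x => w x • b (u x)) (ENNReal.ofReal p).conjExponent ν :=
  (hB.memLp_flux hp hu).smul hw

lemma integrable_mul_comp [Fact (1 ≤ ENNReal.ofReal p)] (hB : ConvexPotential p c B b)
    (hp : 1 < p) (hw : MemLp w ∞ ν) {u : S → E} (hu : MemLp u (ENNReal.ofReal p) ν) :
    Integrable (fun x => w x * B (u x)) ν := by
  have hbound : Integrable (fun x => |B 0| + (‖b (u x)‖ + ‖b 0‖) * ‖u x‖) ν :=
    (integrable_const _).add
      (((hB.memLp_flux hp hu).norm.add (memLp_const ‖b 0‖)).integrable_mul hu.norm)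
  have hBu : Integrable (fun x => B (u x)) ν := by
    refine hbound.mono' (hB.continuous.comp_aestronglyMeasurable hu.1) (.of_forall fun x => ?_)
    have := hB.abs_sub_le (u x) 0
    rw [sub_zero] at this
    linarith [Real.norm_eq_abs (B (u x)), abs_sub_abs_le_abs_sub (B (u x)) (B 0)]
  exact memLp_one_iff_integrable.1 ((memLp_one_iff_integrable.2 hBu).smul hw)

lemma integral_subgradient_le [Fact (1 ≤ ENNReal.ofReal p)] (hB : ConvexPotential p c B b)
    (hp : 1 < p) (hw : MemLp w ∞ ν) (hw₁ : 0 ≤ w₁) (hle : ∀ᵐ x ∂ν, w₁ ≤ w x) {u v : S → E}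
    (hu : MemLp u (ENNReal.ofReal p) ν) (hv : MemLp v (ENNReal.ofReal p) ν) :
    ∫ x, w x * B (u x) ∂ν + ∫ x, inner ℝ (w x • b (u x)) (v x - u x) ∂ν
      + c * w₁ * ∫ x, ‖v x - u x‖ ^ p ∂ν ≤ ∫ x, w x * B (v x) ∂ν := by
  have hBu := hB.integrable_mul_comp hp hw hu
  have hflux : Integrable (fun x => inner ℝ (w x • b (u x)) (v x - u x)) ν :=
    integrable_inner_of_memLp (hB.memLp_smul_flux hp hw hu) (hv.sub hu)
  have hadd : Integrable (fun x => w x * B (u x) + inner ℝ (w x • b (u x)) (v x - u x)) ν :=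
    hBu.add hflux
  have hnorm : Integrable (fun x => c * w₁ * ‖v x - u x‖ ^ p) ν :=
    (integrable_norm_rpow_of_memLp (by linarith) (hv.sub hu)).const_mul _
  rw [← integral_const_mul, ← integral_add hBu hflux, ← integral_add hadd hnorm]
  refine integral_mono_ae (hadd.add hnorm) (hB.integrable_mul_comp hp hw hv) ?_
  filter_upwards [hle] with x hx
  have hsub := mul_le_mul_of_nonneg_left (hB.subgradient_le (u x) (v x)) (hw₁.trans hx)
  have hmod := mul_le_mul_of_nonneg_right hx
    (mul_nonneg hB.modulus_nonneg (by positivity : 0 ≤ ‖v x - u x‖ ^ p))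
  rw [real_inner_smul_left]
  linarith

lemma continuousAt_integral_inner_flux [Fact (1 ≤ ENNReal.ofReal p)]
    (hB : ConvexPotential p c B b) (hp : 1 < p) (hw : MemLp w ∞ ν) {u v : S → E}
    (hu : MemLp u (ENNReal.ofReal p) ν) (hv : MemLp v (ENNReal.ofReal p) ν) :
    ContinuousAt (fun t : ℝ => ∫ x, inner ℝ (w x • b (u x + t • v x)) (v x) ∂ν) 0 := by
  obtain ⟨K, hK⟩ := hB.exists_norm_flux_add_smul_le hp
  set G : S → ℝ := fun x => (1 + ‖‖u x‖ + ‖v x‖‖) ^ (p - 1)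
  have hG : MemLp G (ENNReal.ofReal p).conjExponent ν :=
    memLp_one_add_norm_rpow hp (hu.norm.add hv.norm)
  have hwG : MemLp (fun x => ‖w x‖ * (K * G x)) (ENNReal.ofReal p).conjExponent ν :=
    (hG.const_mul K).mul hw.norm
  refine continuousAt_of_dominated (.of_forall fun t => ?_) ?_ (hwG.integrable_mul hv.norm)
    (.of_forall fun x => ?_)
  · exact (hw.1.smul (hB.continuous_flux.comp_aestronglyMeasurable
      (hu.1.add (hv.1.const_smul t)))).inner hv.1
  · filter_upwards [Metric.closedBall_mem_nhds (0 : ℝ) one_pos] with t ht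
    refine .of_forall fun x => ?_
    have hflux := hK (u x) (v x) t (mem_closedBall_zero_iff.1 ht)
    calc ‖inner ℝ (w x • b (u x + t • v x)) (v x)‖
        ≤ ‖w x‖ * ‖b (u x + t • v x)‖ * ‖v x‖ := by
          rw [← norm_smul]
          exact norm_inner_le_norm _ _
      _ ≤ ‖w x‖ * (K * G x) * ‖v x‖ := by gcongr
  · have := hB.continuous_flux
    fun_prop

theorem exists_convexFunctional_integral [Fact (1 ≤ ENNReal.ofReal p)]
    (hB : ConvexPotential p c B b) (hp : 1 < p) (hw : MemLp w ∞ ν) (hw₁ : 0 ≤ w₁)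
    (hle : ∀ᵐ x ∂ν, w₁ ≤ w x) :
    ∃ A : Lp E (ENNReal.ofReal p) ν → Lp E (ENNReal.ofReal p) ν →L[ℝ] ℝ,
      (∀ u v, A u v = ∫ x, w x * inner ℝ (b (u x)) (v x) ∂ν) ∧
      ConvexFunctional p (c * w₁) (fun u => ∫ x, w x * B (u x) ∂ν) A := by
  refine ⟨fun u => lpIntegralCLM (innerSL ℝ) (hB.memLp_smul_flux hp hw (Lp.memLp u)), fun u v => ?_,
    mul_nonneg hB.modulus_nonneg hw₁, fun u v => ?_, fun u v => ?_⟩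
  · simp only [lpIntegralCLM_innerSL_apply, real_inner_smul_left]
  · have hsub := Lp.coeFn_sub v u
    convert hB.integral_subgradient_le hp hw hw₁ hle (Lp.memLp u) (Lp.memLp v) using 3
    · rw [lpIntegralCLM_innerSL_apply]
      refine integral_congr_ae ?_
      filter_upwards [hsub] with x hx
      rw [hx, Pi.sub_apply]
    · rw [norm_rpow_eq_integral (by linarith)]
      refine integral_congr_ae ?_
      filter_upwards [hsub] with x hx
      rw [hx, Pi.sub_apply]
  · convert hB.continuousAt_integral_inner_flux hp hw (Lp.memLp u) (Lp.memLp v) using 2 with t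
    rw [lpIntegralCLM_innerSL_apply]
    refine integral_congr_ae ?_
    filter_upwards [Lp.coeFn_add u (t • v), Lp.coeFn_smul t v] with x hadd hsmul
    rw [hadd, Pi.add_apply, hsmul, Pi.smul_apply]

theorem existsUnique_integral_add_integral_eq [Fact (1 ≤ ENNReal.ofReal p)]
    {X E' : Type*} [NormedAddCommGroup X] [NormedSpace ℝ X] [CompleteSpace X]
    [NormedAddCommGroup E'] [InnerProductSpace ℝ E'] {c' k : ℝ} {B' : E' → ℝ} {b' : E' → E'}
    (hB : ConvexPotential p c B b) (hc : 0 < c) (hB' : ConvexPotential p c' B' b') (hp : 1 < p)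
    (hw : MemLp w ∞ ν) (hw₁ : 0 < w₁) (hle : ∀ᵐ x ∂ν, w₁ ≤ w x) (hk : 0 < k)
    (D : X →L[ℝ] Lp E (ENNReal.ofReal p) ν) (hD : ∀ u, k * ‖u‖ ≤ ‖D u‖)
    (ι : X →L[ℝ] Lp E' (ENNReal.ofReal p) ν) (F : X →L[ℝ] ℝ) :
    ∃! u, ∀ v, ∫ x, w x * inner ℝ (b (D u x)) (D v x) ∂ν
      + ∫ x, inner ℝ (b' (ι u x)) (ι v x) ∂ν = F v := by
  obtain ⟨A, hA, hJ⟩ := hB.exists_convexFunctional_integral hp hw hw₁.le hle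
  obtain ⟨A', hA', hJ'⟩ := hB'.exists_convexFunctional_integral (ν := ν) hp
    (memLp_const (1 : ℝ)) zero_le_one (.of_forall fun _ => le_rfl)
  have henergy := ((hJ.comp (by linarith) D hk.le hD).add
    (hJ'.comp (by linarith) ι le_rfl fun u => by simp)).sub_clm F
  have hmodulus : 0 < c * w₁ * k ^ p + c' * 1 * 0 ^ p := by
    rw [Real.zero_rpow (by linarith), mul_zero, add_zero]
    positivity
  refine (existsUnique_congr fun u => ?_).1 (henergy.existsUnique_eq_zero hmodulus hp)
  rw [sub_eq_zero, ContinuousLinearMap.ext_iff]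
  simp only [add_apply, ContinuousLinearMap.comp_apply, hA, hA', one_mul]

end ConvexPotential

end IntegralFunctional

section Sobolev

lemma exists_sobolev_exponent {q n : ℝ≥0} (hq : 1 ≤ q) (hn : 1 < n) :
    ∃ r, 1 ≤ r ∧ r < n ∧ r⁻¹ ≤ q⁻¹ + n⁻¹ ∧ r ≤ q := by
  have hq₀ : 0 < q := one_pos.trans_le hq
  have hn₀ : 0 < n := one_pos.trans hn
  refine ⟨max 1 (q⁻¹ + n⁻¹)⁻¹, le_max_left _ _, max_lt hn ?_, ?_, max_le hq ?_⟩
  · exact inv_lt_of_inv_lt₀ hn₀ (lt_add_of_pos_left _ (by positivity))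
  · exact inv_le_of_inv_le₀ (by positivity) (le_max_right _ _)
  · exact inv_le_of_inv_le₀ hq₀ (le_add_of_nonneg_right (by positivity))

lemma eLpNorm_le_eLpNorm_mul_rpow_of_support_subset {S E : Type*} [MeasurableSpace S]
    [NormedAddCommGroup E] {m : Measure S} {s : Set S} {f : S → E} {r q : ℝ≥0∞}
    (hf : AEStronglyMeasurable f m) (hsupp : Function.support f ⊆ s) (hrq : r ≤ q) :
    eLpNorm f r m ≤ eLpNorm f q m * m s ^ (1 / r.toReal - 1 / q.toReal) := by
  rw [← eLpNorm_restrict_eq_of_support_subset (p := r) hsupp,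
    ← eLpNorm_restrict_eq_of_support_subset (p := q) (μ := m) hsupp,
    ← Measure.restrict_apply_univ s]
  exact eLpNorm_le_eLpNorm_mul_rpow_measure_univ hrq hf.restrict

/-- Friedrichs' inequality. For `q` below the dimension it is weaker than the Sobolev inequality;
in general the Sobolev inequality is applied at an exponent `r` with Sobolev exponent at least `q`,
and the `L^r` norm of the derivative is bounded by its `L^q` norm on the bounded set `closure s`. -/
theorem exists_eLpNorm_le_mul_eLpNorm_fderiv {E F : Type*} [NormedAddCommGroup E] [NormedSpace ℝ E]
    [FiniteDimensional ℝ E] [MeasurableSpace E] [BorelSpace E] [NormedAddCommGroup F]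
    [NormedSpace ℝ F] [FiniteDimensional ℝ F] (m : Measure E) [m.IsAddHaarMeasure]
    (hE : 1 < Module.finrank ℝ E) {s : Set E} (hs : Bornology.IsBounded s) {q : ℝ≥0}
    (hq : 1 ≤ q) :
    ∃ C : ℝ≥0, ∀ u : E → F, ContDiff ℝ 1 u → Function.support u ⊆ s →
      eLpNorm u q m ≤ C * eLpNorm (fderiv ℝ u) q m := by
  obtain ⟨r, hr, hrE, hrq, hr_le⟩ :=
    exists_sobolev_exponent hq (n := Module.finrank ℝ E) (by exact_mod_cast hE)
  set K : ℝ≥0∞ := m (closure s) ^ (1 / (r : ℝ≥0∞).toReal - 1 / (q : ℝ≥0∞).toReal)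
  have hK : K ≠ ∞ := by
    refine ENNReal.rpow_ne_top_of_nonneg (sub_nonneg.2 ?_) ?_
    · exact one_div_le_one_div_of_le (by simpa using one_pos.trans_le hr) (by simpa using hr_le)
    · exact hs.closure.measure_lt_top.ne
  lift K to ℝ≥0 using hK with K' hK'
  refine ⟨eLpNormLESNormFDerivOfLeConst F m s r q * K', fun u hu hsupp => ?_⟩
  have hsobolev := eLpNorm_le_eLpNorm_fderiv_of_le m hu hsupp hr hrE
    (sub_le_iff_le_add.2 (by exact_mod_cast hrq)) hs
  have hholder : eLpNorm (fderiv ℝ u) r m ≤ eLpNorm (fderiv ℝ u) q m * K' :=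
    hK' ▸ eLpNorm_le_eLpNorm_mul_rpow_of_support_subset
      (hu.continuous_fderiv one_ne_zero).aestronglyMeasurable
      ((support_fderiv_subset ℝ).trans (closure_mono hsupp)) (by exact_mod_cast hr_le)
  calc eLpNorm u q m
      ≤ eLpNormLESNormFDerivOfLeConst F m s r q * eLpNorm (fderiv ℝ u) r m := hsobolev
    _ ≤ eLpNormLESNormFDerivOfLeConst F m s r q * (eLpNorm (fderiv ℝ u) q m * K') := by gcongr
    _ = _ := by
      push_cast
      ring

variable {Ω : Opens Plane} {q : ℝ≥0∞}

lemma eLpNorm_fderiv_eq_eLpNorm_gradient (φ : 𝓓(Ω, ℝ)) (m : Measure Plane) :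
    eLpNorm (fderiv ℝ φ) q m = eLpNorm (gradient φ) q m :=
  eLpNorm_congr_norm_ae (.of_forall fun x => by simp [gradient])

variable [Fact (1 ≤ q)]

lemma isClosed_sobolevW : IsClosed (SobolevW Ω q : Set (LpScalar Ω q × LpVector Ω q)) := by
  have hset : (SobolevW Ω q : Set (LpScalar Ω q × LpVector Ω q)) =
      ⋂ φ : 𝓓(Ω, ℝ), {w | ∫ x in Ω, w.1 x • gradient φ x = -∫ x in Ω, φ x • w.2 x} := by
    ext w
    simp only [mem_iInter]
    rfl
  rw [hset]
  refine isClosed_iInter fun φ => isClosed_eq ?_ (Continuous.neg ?_)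
  · have hφ : MemLp (gradient φ) q.conjExponent (volume.restrict (Ω : Set Plane)) :=
      (continuous_gradient φ).memLp_of_hasCompactSupport (hasCompactSupport_gradient φ)
    refine ((lpIntegralCLM (ContinuousLinearMap.lsmul ℝ ℝ).flip hφ).continuous.comp
      continuous_fst).congr fun w => ?_
    exact lpIntegralCLM_apply _ hφ w.1
  · have hφ : MemLp φ q.conjExponent (volume.restrict (Ω : Set Plane)) :=
      φ.continuous.memLp_of_hasCompactSupport φ.hasCompactSupport
    refine ((lpIntegralCLM (ContinuousLinearMap.lsmul ℝ ℝ) hφ).continuous.comp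
      continuous_snd).congr fun w => ?_
    exact lpIntegralCLM_apply _ hφ w.2

instance completeSpace_sobolevW : CompleteSpace (SobolevW Ω q) :=
  isClosed_sobolevW.completeSpace_coe

instance completeSpace_sobolevW0 : CompleteSpace (SobolevW0 Ω q) :=
  (testSubmodule Ω q).isClosed_topologicalClosure.completeSpace_coe

variable (Ω q) in
/-- The inclusion of `W₀^{1,q}(Ω)` into `L^q(Ω)`. -/
noncomputable def SobolevW0.toLpCLM : SobolevW0 Ω q →L[ℝ] LpScalar Ω q :=
  (ContinuousLinearMap.fst ℝ _ _).comp ((SobolevW Ω q).subtypeL.comp (SobolevW0 Ω q).subtypeL)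

variable (Ω q) in
/-- The weak gradient, as a continuous linear map from `W₀^{1,q}(Ω)` to `L^q(Ω; ℝ²)`. -/
noncomputable def SobolevW0.gradientCLM : SobolevW0 Ω q →L[ℝ] LpVector Ω q :=
  (ContinuousLinearMap.snd ℝ _ _).comp ((SobolevW Ω q).subtypeL.comp (SobolevW0 Ω q).subtypeL)

lemma exists_eLpNorm_le_mul_eLpNorm_gradient (hΩ : Bornology.IsBounded (Ω : Set Plane))
    (hq : q ≠ ∞) :
    ∃ C : ℝ≥0, ∀ φ : 𝓓(Ω, ℝ), eLpNorm φ q (volume.restrict (Ω : Set Plane))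
      ≤ C * eLpNorm (gradient φ) q (volume.restrict (Ω : Set Plane)) := by
  lift q to ℝ≥0 using hq
  obtain ⟨C, hC⟩ := exists_eLpNorm_le_mul_eLpNorm_fderiv (F := ℝ) (volume : Measure Plane)
    (by simp [Plane]) hΩ (q := q) (by exact_mod_cast (Fact.out : 1 ≤ (q : ℝ≥0∞)))
  refine ⟨C, fun φ => ?_⟩
  have hsupp : Function.support φ ⊆ Ω := (subset_tsupport _).trans φ.tsupport_subset
  have hsupp' : Function.support (gradient φ) ⊆ Ω := by
    refine Subset.trans (fun x hx => ?_) ((support_fderiv_subset ℝ).trans φ.tsupport_subset)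
    simpa [gradient] using hx
  have hle := hC φ (φ.contDiff.of_le (by simp)) hsupp
  rwa [eLpNorm_fderiv_eq_eLpNorm_gradient, ← eLpNorm_restrict_eq_of_support_subset hsupp,
    ← eLpNorm_restrict_eq_of_support_subset hsupp'] at hle

theorem SobolevW0.exists_norm_toLpCLM_le (hΩ : Bornology.IsBounded (Ω : Set Plane))
    (hq : q ≠ ∞) : ∃ C : ℝ≥0, ∀ u, ‖toLpCLM Ω q u‖ ≤ C * ‖gradientCLM Ω q u‖ := by
  obtain ⟨C, hC⟩ := exists_eLpNorm_le_mul_eLpNorm_gradient (q := q) hΩ hq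
  have hclosed : IsClosed {w : SobolevW Ω q | ‖w.1.1‖ ≤ C * ‖w.1.2‖} :=
    isClosed_le (by fun_prop) (by fun_prop)
  have htest : (testSubmodule Ω q : Set (SobolevW Ω q)) ⊆ {w | ‖w.1.1‖ ≤ C * ‖w.1.2‖} := by
    rintro w ⟨φ, hw, hgrad⟩
    have hφ := hC φ
    rw [← eLpNorm_congr_ae hw, ← eLpNorm_congr_ae hgrad] at hφ
    simpa [Lp.norm_def] using
      ENNReal.toReal_mono (ENNReal.mul_ne_top ENNReal.coe_ne_top (Lp.eLpNorm_ne_top _)) hφ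
  exact ⟨C, fun u => closure_minimal htest hclosed u.2⟩

lemma SobolevW0.exists_mul_norm_le_norm_gradientCLM (hΩ : Bornology.IsBounded (Ω : Set Plane))
    (hq : q ≠ ∞) : ∃ k > 0, ∀ u, k * ‖u‖ ≤ ‖gradientCLM Ω q u‖ := by
  obtain ⟨C, hC⟩ := exists_norm_toLpCLM_le (q := q) hΩ hq
  refine ⟨(max C 1 : ℝ)⁻¹, by positivity, fun u => ?_⟩
  rw [inv_mul_le_iff₀ (by positivity)]
  refine max_le ((hC u).trans ?_) (le_mul_of_one_le_left (norm_nonneg _) (le_max_right _ _))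
  gcongr
  exact le_max_left _ _

end Sobolev

section DirichletProblem

variable {Ω : Opens Plane}

/-- `u` solves the Dirichlet problem `-div (μ g(∇u)) + b(u) = F` in the dual of `W₀^{1,q}(Ω)`. -/
def IsDirichletSolution {q : ℝ≥0∞} [Fact (1 ≤ q)] (μ : Plane → ℝ) (g : Plane → Plane) (b : ℝ → ℝ)
    (F : SobolevW0 Ω q →L[ℝ] ℝ) (u : SobolevW0 Ω q) : Prop :=
  ∀ v, (∫ x in Ω, μ x * inner ℝ (g (weakGrad u x)) (weakGrad v x))
    + ∫ x in Ω, b (toFn u x) * toFn v x = F v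

theorem existsUnique_isDirichletSolution (hΩ : Bornology.IsBounded (Ω : Set Plane))
    {p c c' μ₁ : ℝ} [Fact (1 ≤ ENNReal.ofReal p)] (hp : 1 < p) {μ : Plane → ℝ}
    (hμ : MemLp μ ∞ (volume.restrict (Ω : Set Plane))) (hμ₁ : 0 < μ₁)
    (hle : ∀ᵐ x ∂(volume.restrict (Ω : Set Plane)), μ₁ ≤ μ x) {G : Plane → ℝ} {g : Plane → Plane}
    (hG : ConvexPotential p c G g) (hc : 0 < c) {B : ℝ → ℝ} {b : ℝ → ℝ}
    (hB : ConvexPotential p c' B b) (F : SobolevW0 Ω (ENNReal.ofReal p) →L[ℝ] ℝ) :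
    ∃! u, IsDirichletSolution μ g b F u := by
  have : IsFiniteMeasure (volume.restrict (Ω : Set Plane)) :=
    isFiniteMeasure_restrict.2 hΩ.measure_lt_top.ne
  obtain ⟨k, hk, hgrad⟩ :=
    SobolevW0.exists_mul_norm_le_norm_gradientCLM (q := ENNReal.ofReal p) hΩ ENNReal.ofReal_ne_top
  have henergy := hG.existsUnique_integral_add_integral_eq (X := SobolevW0 Ω (ENNReal.ofReal p))
    hc hB hp hμ hμ₁ hle hk
  refine (existsUnique_congr fun u => forall_congr' fun v => ?_).1
    (henergy (SobolevW0.gradientCLM Ω (ENNReal.ofReal p)) hgrad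
      (SobolevW0.toLpCLM Ω (ENNReal.ofReal p)) F)
  simp only [Real.inner_apply]
  rfl

end DirichletProblem

section PenalizedStep

variable {Ω : Opens Plane}

/-- The functional `v ↦ ∫ f v` on `W₀^{1,q}(Ω)`, for `f` in the dual Lebesgue space of `L^q(Ω)`. -/
noncomputable def SobolevW0.integralMulCLM {q : ℝ≥0∞} [Fact (1 ≤ q)] {f : Plane → ℝ}
    (hf : MemLp f q.conjExponent (volume.restrict (Ω : Set Plane))) : SobolevW0 Ω q →L[ℝ] ℝ :=
  (lpIntegralCLM (ContinuousLinearMap.mul ℝ ℝ) hf).comp (toLpCLM Ω q)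

lemma SobolevW0.integralMulCLM_apply {q : ℝ≥0∞} [Fact (1 ≤ q)] {f : Plane → ℝ}
    (hf : MemLp f q.conjExponent (volume.restrict (Ω : Set Plane))) (v : SobolevW0 Ω q) :
    integralMulCLM hf v = ∫ x in Ω, f x * toFn v x :=
  lpIntegralCLM_apply _ hf _

lemma memLp_extendZero [IsFiniteMeasure (volume.restrict (Ω : Set Plane))] (f : ContClosure Ω)
    (q : ℝ≥0∞) : MemLp (extendZero f) q (volume.restrict (Ω : Set Plane)) := by
  have hmeas : Measurable (extendZero f) :=
    (MeasurableEmbedding.subtype_coe isClosed_closure.measurableSet).measurable_extend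
      f.continuous.measurable measurable_const
  refine .of_bound hmeas.aestronglyMeasurable ‖f‖ ?_
  filter_upwards [ae_restrict_mem Ω.isOpen.measurableSet] with x hx
  have hval : extendZero f x = f ⟨x, subset_closure hx⟩ :=
    Subtype.val_injective.extend_apply f 0 ⟨x, subset_closure hx⟩
  rw [hval]
  exact f.norm_coe_le_norm _

variable {p α κ ℓ : ℝ} [Fact (1 ≤ ENNReal.ofReal p)] {μ : Plane → ℝ}

/-- One step of the penalized implicit scheme, as in `IsStepSolution`, for an arbitrary exponent `α`
and an arbitrary right-hand side `F` in the dual of `W₀^{1,p}(Ω)`. -/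
def IsPenalizedStep (α κ ℓ : ℝ) (μ : Plane → ℝ) (F : SobolevW0 Ω (ENNReal.ofReal p) →L[ℝ] ℝ)
    (uPrev uNext : SobolevW0 Ω (ENNReal.ofReal p)) : Prop :=
  ∀ v : SobolevW0 Ω (ENNReal.ofReal p),
    (1 / ℓ) * (∫ x in Ω, (powerFlux α (toFn uNext x) - powerFlux α (toFn uPrev x)) * toFn v x)
      + (∫ x in Ω, μ x * inner ℝ (powerFlux p (weakGrad uNext x)) (weakGrad v x))
      - (1 / κ) * (∫ x in Ω, negativePart (toFn uNext x) * toFn v x)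
    = F v

lemma isStepSolution_iff [IsFiniteMeasure (volume.restrict (Ω : Set Plane))]
    {a : ℝ → ContClosure Ω} {n : ℕ} {uPrev uNext : SobolevW0 Ω (ENNReal.ofReal p)} :
    IsStepSolution κ ℓ μ a n uPrev uNext ↔ IsPenalizedStep (alpha p) κ ℓ μ
      (SobolevW0.integralMulCLM (memLp_extendZero (sourceMean a ℓ n) _)) uPrev uNext := by
  simp only [IsPenalizedStep, SobolevW0.integralMulCLM_apply]
  rfl

lemma exists_isPenalizedStep_iff_isDirichletSolution
    [IsFiniteMeasure (volume.restrict (Ω : Set Plane))] (hp : 2 ≤ p) (hα : 1 < α) (hαp : α ≤ p)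
    (F : SobolevW0 Ω (ENNReal.ofReal p) →L[ℝ] ℝ) (uPrev : SobolevW0 Ω (ENNReal.ofReal p)) :
    ∃ F' : SobolevW0 Ω (ENNReal.ofReal p) →L[ℝ] ℝ, ∀ uNext,
      IsPenalizedStep α κ ℓ μ F uPrev uNext ↔
      IsDirichletSolution μ (powerFlux p)
        (fun s => (1 / ℓ) • powerFlux α s + (1 / κ) • -negativePart s) F' uNext := by
  have hmem (u : SobolevW0 Ω (ENNReal.ofReal p)) :
      MemLp (toFn u) (ENNReal.ofReal p) (volume.restrict (Ω : Set Plane)) := Lp.memLp u.1.1.1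
  have hpower (u : SobolevW0 Ω (ENNReal.ofReal p)) :
      MemLp (fun x => powerFlux α (toFn u x)) (ENNReal.ofReal p).conjExponent
        (volume.restrict (Ω : Set Plane)) :=
    (convexPotential_powerFlux hα hαp).memLp_flux (by linarith) (hmem u)
  have hneg (u : SobolevW0 Ω (ENNReal.ofReal p)) :
      MemLp (fun x => -negativePart (toFn u x)) (ENNReal.ofReal p).conjExponent
        (volume.restrict (Ω : Set Plane)) :=
    (convexPotential_neg_negativePart hp).memLp_flux (by linarith) (hmem u)
  refine ⟨F + (1 / ℓ) • SobolevW0.integralMulCLM (hpower uPrev), fun u => forall_congr' fun v => ?_⟩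
  have hv := hmem v
  have hdiff : ∫ x in Ω, (powerFlux α (toFn u x) - powerFlux α (toFn uPrev x)) * toFn v x =
      (∫ x in Ω, powerFlux α (toFn u x) * toFn v x)
        - SobolevW0.integralMulCLM (hpower uPrev) v := by
    simp only [sub_mul, SobolevW0.integralMulCLM_apply]
    exact integral_sub ((hpower u).integrable_mul hv) ((hpower uPrev).integrable_mul hv)
  have hsum : ∫ x in Ω, ((1 / ℓ) • powerFlux α (toFn u x) + (1 / κ) • -negativePart (toFn u x)) *
      toFn v x = 1 / ℓ * (∫ x in Ω, powerFlux α (toFn u x) * toFn v x)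
        + 1 / κ * ∫ x in Ω, -negativePart (toFn u x) * toFn v x := by
    simp only [add_mul, smul_eq_mul, mul_assoc]
    rw [← integral_const_mul, ← integral_const_mul]
    exact integral_add (((hpower u).integrable_mul hv).const_mul _)
      (((hneg u).integrable_mul hv).const_mul _)
  rw [hdiff, hsum, add_apply, smul_apply, smul_eq_mul]
  simp only [neg_mul, integral_neg]
  constructor <;> intro h <;> linarith

theorem existsUnique_isPenalizedStep (hΩ : Bornology.IsBounded (Ω : Set Plane)) (hp : 2 ≤ p)
    (hα : 1 < α) (hαp : α ≤ p) (hκ : 0 < κ) (hℓ : 0 < ℓ)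
    (hμ : MemLp μ ∞ (volume.restrict (Ω : Set Plane))) {μ₁ : ℝ} (hμ₁ : 0 < μ₁)
    (hle : ∀ᵐ x ∂(volume.restrict (Ω : Set Plane)), μ₁ ≤ μ x)
    (F : SobolevW0 Ω (ENNReal.ofReal p) →L[ℝ] ℝ) (uPrev : SobolevW0 Ω (ENNReal.ofReal p)) :
    ∃! uNext, IsPenalizedStep α κ ℓ μ F uPrev uNext := by
  have : IsFiniteMeasure (volume.restrict (Ω : Set Plane)) :=
    isFiniteMeasure_restrict.2 hΩ.measure_lt_top.ne
  obtain ⟨F', hF'⟩ := exists_isPenalizedStep_iff_isDirichletSolution hp hα hαp F uPrev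
  have hlower := ((convexPotential_powerFlux hα hαp).const_mul (one_div_pos.2 hℓ).le).add
    ((convexPotential_neg_negativePart hp).const_mul (one_div_pos.2 hκ).le)
  exact (existsUnique_congr hF').2 (existsUnique_isDirichletSolution hΩ (by linarith) hμ hμ₁ hle
    (uniformlyConvexPotential_powerFlux hp) (by positivity) hlower F')

end PenalizedStep

lemma one_lt_alpha {p : ℝ} (hp : 1 < p) : 1 < alpha p := by
  rw [alpha, lt_div_iff₀ (by linarith)]
  linarith

lemma alpha_le {p : ℝ} (hp : 2 ≤ p) : alpha p ≤ p := by
  rw [alpha, div_le_iff₀ (by linarith)]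
  nlinarith

lemma existsUnique_fin_sequence {X : Type*} {N : ℕ} {R : Fin N → X → X → Prop}
    (h : ∀ n x, ∃! y, R n x y) (x₀ : X) :
    ∃! u : Fin (N + 1) → X, u 0 = x₀ ∧ ∀ n : Fin N, R n (u n.castSucc) (u n.succ) := by
  choose next hnext hunique using h
  refine ⟨fun i => Fin.induction x₀ next i, ⟨rfl, fun n => hnext n _⟩, fun u ⟨hu₀, hu⟩ => ?_⟩
  funext i
  induction i using Fin.induction with
  | zero => exact hu₀
  | succ i ih => exact (hunique i _ _ (hu i)).trans (congrArg (next i) ih)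

end IceSheet

theorem mainTheorem4_general {Ω : Opens Plane} (hΩ : Bornology.IsBounded (Ω : Set Plane))
    {p α κ ℓ : ℝ} [Fact (1 ≤ ENNReal.ofReal p)] (hp : 2 ≤ p) (hα : 1 < α) (hαp : α ≤ p)
    (hκ : 0 < κ) (hℓ : 0 < ℓ) {μ : Plane → ℝ} (hμ : MemLp μ ∞ (volume.restrict (Ω : Set Plane)))
    {μ₁ : ℝ} (hμ₁ : 0 < μ₁) (hle : ∀ᵐ x ∂(volume.restrict (Ω : Set Plane)), μ₁ ≤ μ x) (N : ℕ)
    (F : ℕ → SobolevW0 Ω (ENNReal.ofReal p) →L[ℝ] ℝ) :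
    (∀ n uPrev, ∃! uNext, IsPenalizedStep α κ ℓ μ (F n) uPrev uNext) ∧
    ∀ u₀, ∃! u : Fin (N + 1) → SobolevW0 Ω (ENNReal.ofReal p),
      u 0 = u₀ ∧ ∀ n : Fin N, IsPenalizedStep α κ ℓ μ (F n) (u n.castSucc) (u n.succ) := by
  have hstep (n : ℕ) := existsUnique_isPenalizedStep hΩ hp hα hαp hκ hℓ hμ hμ₁ hle (F n)
  exact ⟨hstep, existsUnique_fin_sequence fun n => hstep n⟩

theorem mainTheorem4
    (T : ℝ) (hT : 0 < T)
    (Ω : Opens Plane) (hΩ : IsLipschitzDomain Ω)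
    (p : ℝ) (hp : 2.8 ≤ p ∧ p ≤ 5) [Fact (1 ≤ ENNReal.ofReal p)]
    (κ : ℝ) (hκ : 0 < κ)
    (N : ℕ) (hN : 1 ≤ N) (ℓ : ℝ) (hℓ : ℓ = T / N)
    (μ : Plane → ℝ) (hμ : AEStronglyMeasurable μ (volume.restrict (Ω : Set Plane)))
    (μ₁ μ₂ : ℝ) (hμ₁ : 0 < μ₁) (hμ₂ : 0 < μ₂)
    (hμbd : ∀ x ∈ closure (Ω : Set Plane), μ₁ ≤ μ x ∧ μ x ≤ μ₂)
    (a : ℝ → ContClosure Ω) (ha : MemTimeSobolev (ENNReal.ofReal p) T a) :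
    (∀ n < N, ∀ uPrev : SobolevW0 Ω (ENNReal.ofReal p),
      ∃! uNext : SobolevW0 Ω (ENNReal.ofReal p), IsStepSolution κ ℓ μ a n uPrev uNext) ∧
    (∀ u₀ ∈ nonnegCone Ω (ENNReal.ofReal p),
      ∃! u : Fin (N + 1) → SobolevW0 Ω (ENNReal.ofReal p),
        u 0 = u₀ ∧ ∀ n : Fin N, IsStepSolution κ ℓ μ a n (u n.castSucc) (u n.succ)) := by
  have : IsFiniteMeasure (volume.restrict (Ω : Set Plane)) :=
    isFiniteMeasure_restrict.2 hΩ.isBounded.measure_lt_top.ne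
  have hℓ₀ : 0 < ℓ := hℓ ▸ div_pos hT (by exact_mod_cast hN)
  have hp₂ : 2 ≤ p := by linarith [hp.1]
  have hbd : ∀ᵐ x ∂(volume.restrict (Ω : Set Plane)), μ₁ ≤ μ x ∧ μ x ≤ μ₂ :=
    ae_restrict_of_forall_mem Ω.isOpen.measurableSet fun x hx => hμbd x (subset_closure hx)
  have hμ_bounded : MemLp μ ∞ (volume.restrict (Ω : Set Plane)) :=
    memLp_of_bounded (hbd.mono fun _ hx => hx) hμ ∞
  simp only [isStepSolution_iff]
  obtain ⟨hstep, hsequence⟩ := mainTheorem4_general hΩ.isBounded hp₂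
    (one_lt_alpha (by linarith)) (alpha_le hp₂) hκ hℓ₀ hμ_bounded hμ₁ (hbd.mono fun _ hx => hx.1) N
    fun n => SobolevW0.integralMulCLM (memLp_extendZero (sourceMean a ℓ n) _)
  exact ⟨fun n _ => hstep n, fun u₀ _ => hsequence u₀⟩
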